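/- Let $A$ be a linearly ordered alphabet (for instance the positive integers). Two words $w_1,w_2$ over $A$ are *Sylvester adjacent* if there are words $u,v,w$ over $A$ and letters $a\le b<c$ such that $w_1=u\,ac\,v\,b\,w$ and $w_2=u\,ca\,v\,b\,w$. Two words are *Sylvester equivalent* if they are joined by a finite sequence of words in which any two consecutive words are Sylvester adjacent (in either order); the equivalence classes are called Sylvester classes. The *content* of a word is the multiset of its letters. If the distinct letters of a finite multiset are $x_1<\dots<x_k$, its *packed content* is the sequence $(\alpha_1,\dots,\alpha_k)$, where $\alpha_i\ge 1$ is the multiplicity of $x_i$. **Theorem.** Let $\alpha=(\alpha_1,\dots,\alpha_k)\vDash n$ be a composition of $n$ with $k$ parts, and fix a content (a finite multiset of letters of $A$) whose packed content is $\alpha$. Then the number of Sylvester classes of words with this content is $$\det\left[\binom{\,j+\sum_{\ell=1}^{i}\alpha_{k+1-\ell}\,}{j-i+1}\right]_{1\le i,j\le k-1},$$ where $\binom{N}{r}=0$ for $r<0$ and the determinant of the empty matrix (the case $k\le 1$) is $1$. -/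

import Mathlib

/-- Sylvester adjacency of words over a linearly ordered alphabet: `u a c v b w` and
`u c a v b w` are adjacent whenever `a ≤ b < c` are letters and `u`, `v`, `w` are words. -/
def SylvesterAdj {A : Type*} [LinearOrder A] (w₁ w₂ : List A) : Prop :=
  ∃ (u v w : List A) (a b c : A), a ≤ b ∧ b < c ∧
    w₁ = u ++ [a, c] ++ v ++ [b] ++ w ∧ w₂ = u ++ [c, a] ++ v ++ [b] ++ w

/-- Sylvester equivalence: two words are equivalent when they are joined by a finite sequence of
words in which consecutive words are Sylvester adjacent (in one order or the other). -/
def sylvesterSetoid (A : Type*) [LinearOrder A] : Setoid (List A) :=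
  Relation.EqvGen.setoid SylvesterAdj

/-- The set of Sylvester classes of the words with content `m`, that is, of the words that are
rearrangements of the multiset of letters `m`. -/
def sylvesterClasses {A : Type*} [LinearOrder A] (m : Multiset A) :
    Set (Quotient (sylvesterSetoid A)) :=
  Quotient.mk (sylvesterSetoid A) '' {w : List A | (w : Multiset A) = m}

/-- The packed content of a multiset of letters: if the distinct letters that occur are
`x₁ < ⋯ < x_k`, it is the list of their (positive) multiplicities, in this order. -/
def packedContent {A : Type*} [LinearOrder A] (m : Multiset A) : List ℕ :=
  (m.toFinset.sort (· ≤ ·)).map fun x => m.count x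

/-- The binomial coefficient with an integer lower index: it vanishes if that index is negative. -/
def binom (N : ℕ) (r : ℤ) : ℤ :=
  if 0 ≤ r then (N.choose r.toNat : ℤ) else 0

/-- The matrix with entries `binom (j + ∑_{ℓ=1}^{i} α_{k+1-ℓ}) (j - i + 1)`, `1 ≤ i, j ≤ k - 1`,
where `k` is the number of parts of `α`. Indices start at `0` here, so that `i`, `j`, `ℓ` of the
formula are `i + 1`, `j + 1`, `ℓ + 1`, and `α_{k+1-ℓ}` of the formula is the `ℓ`-th part counted
from the end. -/
def sylvesterMatrix {n : ℕ} (α : Composition n) :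
    Matrix (Fin (α.length - 1)) (Fin (α.length - 1)) ℤ :=
  Matrix.of fun i j =>
    binom (((j : ℕ) + 1) + ∑ ℓ ∈ Finset.univ.filter (fun ℓ : Fin α.length => (ℓ : ℕ) ≤ (i : ℕ)),
        α.blocksFun ℓ.rev)
      ((((j : ℕ) : ℤ) + 1) - (((i : ℕ) : ℤ) + 1) + 1)

/-!
The classes are counted by adding the letters one at a time, from the largest to the smallest,
while recording the number of weak right-to-left minima of a word (`rlMin`), which is constant on
Sylvester classes.

Let `x` be smaller than all letters of a word `t`. All copies of `x` except the last one move
freely to the front, and the last copy moves freely over letters that are not right-to-left minima.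
So the classes of the words that restrict to the class of `t` and contain `a ≥ 1` copies of `x`
correspond to the numbers `j ≤ rlMin t` of right-to-left minima of `t` behind the last `x`
(`sum_sylvesterClasses_of_min`), and such a word has `a + j` right-to-left minima. With
`(T_a g)(t) = ∑_{j ≤ t} g (a + j)`, the number of classes is therefore the value at `0` of
`T_{β 0} (T_{β 1} (⋯ (T_{β (k - 1)} 1)))`, where `β` is the content read from the largest letter
to the smallest (`sum_sylvesterClasses`).

The matrix is a Hessenberg matrix with unit subdiagonal. Let `D i` be the number of classes
with content `β 0, …, β i`. Splitting binomial coefficients with Pascal's rule gives a telescoping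
alternating sum (`sum_choose_mul_iterShiftSum`), which is the expansion of a leading principal minor
along its last column with the `D i` in the place of the smaller minors. Hence the determinant
is `D (k - 1)` (`det_hessenberg`).
-/

/-! ### Moves in context -/

/-- The number of weak right-to-left minima of a word: the letters that are at most every letter
to their right. -/
def rlMin {A : Type*} [LinearOrder A] : List A → ℕ
  | [] => 0
  | c :: w => (if ∀ d ∈ w, c ≤ d then 1 else 0) + rlMin w

section Words

variable {A : Type*} [LinearOrder A]

theorem SylvesterAdj.append_left (p : List A) {w₁ w₂ : List A} (h : SylvesterAdj w₁ w₂) :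
    SylvesterAdj (p ++ w₁) (p ++ w₂) := by
  obtain ⟨u, v, w, a, b, c, hab, hbc, rfl, rfl⟩ := h
  exact ⟨p ++ u, v, w, a, b, c, hab, hbc, by simp, by simp⟩

theorem eqvGen_append_left (p : List A) {w₁ w₂ : List A}
    (h : Relation.EqvGen SylvesterAdj w₁ w₂) :
    Relation.EqvGen SylvesterAdj (p ++ w₁) (p ++ w₂) := by
  induction h with
  | rel _ _ h => exact .rel _ _ (h.append_left p)
  | refl => exact .refl _
  | symm _ _ _ ih => exact ih.symm
  | trans _ _ _ _ _ ih₁ ih₂ => exact ih₁.trans _ _ _ ih₂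

theorem eqvGen_cons (c : A) {w₁ w₂ : List A} (h : Relation.EqvGen SylvesterAdj w₁ w₂) :
    Relation.EqvGen SylvesterAdj (c :: w₁) (c :: w₂) :=
  eqvGen_append_left [c] h

theorem eqvGen_swap {a b c : A} {s : List A} (hb : b ∈ s) (hab : a ≤ b) (hbc : b < c) :
    Relation.EqvGen SylvesterAdj (a :: c :: s) (c :: a :: s) := by
  obtain ⟨v, w, rfl⟩ := List.append_of_mem hb
  exact .rel _ _ ⟨[], v, w, a, b, c, hab, hbc, by simp, by simp⟩

/-- A block of letters that are all at most `b` commutes with `c > b` when `b` occurs later. -/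
theorem eqvGen_block_swap {b c : A} {s : List A} (hb : b ∈ s) (hbc : b < c) (p : List A)
    (hp : ∀ a ∈ p, a ≤ b) :
    Relation.EqvGen SylvesterAdj (p ++ c :: s) (c :: (p ++ s)) := by
  induction p with
  | nil => exact .refl _
  | cons a p ih =>
    refine (eqvGen_cons a (ih fun d hd => hp d (by simp [hd]))).trans _ _ _ ?_
    exact eqvGen_swap (by simp [hb]) (hp a (by simp)) hbc

theorem SylvesterAdj.perm {w₁ w₂ : List A} (h : SylvesterAdj w₁ w₂) : w₁.Perm w₂ := by
  obtain ⟨u, v, w, a, b, c, -, -, rfl, rfl⟩ := h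
  simp only [List.append_assoc]
  exact List.Perm.append_left _ (List.Perm.append_right _ (List.Perm.swap _ _ _))

theorem eqvGen_perm {w₁ w₂ : List A} (h : Relation.EqvGen SylvesterAdj w₁ w₂) :
    w₁.Perm w₂ := by
  induction h with
  | rel _ _ h => exact h.perm
  | refl => exact .refl _
  | symm _ _ _ ih => exact ih.symm
  | trans _ _ _ _ _ ih₁ ih₂ => exact ih₁.trans ih₂

/-! ### Right-to-left minima as an invariant -/

theorem rlMin_append_congr (u : List A) {s t : List A} (hst : s.Perm t) (h : rlMin s = rlMin t) :
    rlMin (u ++ s) = rlMin (u ++ t) := by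
  induction u with
  | nil => exact h
  | cons c u ih =>
    simp only [List.cons_append, rlMin, ih]
    congr 2
    simp only [(hst.append_left u).mem_iff]

theorem rlMin_eq_of_adj {w₁ w₂ : List A} (h : SylvesterAdj w₁ w₂) : rlMin w₁ = rlMin w₂ := by
  obtain ⟨u, v, w, a, b, c, hab, hbc, rfl, rfl⟩ := h
  simp only [List.append_assoc]
  refine rlMin_append_congr u (List.Perm.append_right _ (List.Perm.swap _ _ _)) ?_
  have hac : a ≤ c := hab.trans hbc.le
  have h₁ : ¬ ∀ d ∈ v ++ ([b] ++ w), c ≤ d := fun h => absurd (h b (by simp)) hbc.not_ge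
  have h₂ : ¬ ∀ d ∈ a :: (v ++ ([b] ++ w)), c ≤ d := fun h => absurd (h b (by simp)) hbc.not_ge
  have h₃ : (∀ d ∈ c :: (v ++ ([b] ++ w)), a ≤ d) ↔ ∀ d ∈ v ++ ([b] ++ w), a ≤ d := by
    rw [List.forall_mem_cons]; exact and_iff_right hac
  simp only [List.cons_append, List.nil_append] at h₁ h₂ h₃ ⊢
  simp only [rlMin, if_neg h₁, if_neg h₂, h₃]
  omega

theorem rlMin_eq_of_eqvGen {w₁ w₂ : List A} (h : Relation.EqvGen SylvesterAdj w₁ w₂) :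
    rlMin w₁ = rlMin w₂ := by
  induction h with
  | rel _ _ h => exact rlMin_eq_of_adj h
  | refl => rfl
  | symm _ _ _ ih => exact ih.symm
  | trans _ _ _ _ _ ih₁ ih₂ => exact ih₁.trans ih₂

theorem rlMin_le_append (s t : List A) : rlMin t ≤ rlMin (s ++ t) := by
  induction s with
  | nil => exact le_rfl
  | cons c s ih => exact ih.trans (Nat.le_add_left _ _)

/-- Every value up to `rlMin t` is attained by a suffix, since one letter changes `rlMin` by at
most one. -/
theorem exists_suffix_rlMin_eq (t : List A) {j : ℕ} (hj : j ≤ rlMin t) :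
    ∃ u v, t = u ++ v ∧ rlMin v = j := by
  induction t with
  | nil => exact ⟨[], [], rfl, (Nat.le_zero.1 hj).symm⟩
  | cons c t ih =>
    by_cases h : j ≤ rlMin t
    · obtain ⟨u, v, rfl, hv⟩ := ih h
      exact ⟨c :: u, v, rfl, hv⟩
    · refine ⟨[], c :: t, rfl, le_antisymm ?_ hj⟩
      have : rlMin (c :: t) ≤ 1 + rlMin t := by
        simp only [rlMin]; split_ifs <;> omega
      omega

theorem rlMin_replicate_append (x : A) (n : ℕ) {u v : List A} (hu : ∀ c ∈ u, x < c)
    (hv : ∀ c ∈ v, x < c) :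
    rlMin (List.replicate n x ++ (u ++ x :: v)) = n + 1 + rlMin v := by
  induction n with
  | zero =>
    induction u with
    | nil =>
      have : ∀ d ∈ v, x ≤ d := fun d hd => (hv d hd).le
      simp only [List.replicate_zero, List.nil_append, rlMin, if_pos this]
    | cons c u ih =>
      have h : ¬ ∀ d ∈ u ++ x :: v, c ≤ d := fun h =>
        absurd (h x (by simp)) (hu c (by simp)).not_ge
      have := ih fun d hd => hu d (by simp [hd])
      simp only [List.replicate_zero, List.nil_append, List.cons_append, rlMin, if_neg h] at this ⊢
      omega
  | succ n ih =>
    have h : ∀ d ∈ List.replicate n x ++ (u ++ x :: v), x ≤ d := by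
      intro d hd
      simp only [List.mem_append, List.mem_replicate, List.mem_cons] at hd
      rcases hd with ⟨-, rfl⟩ | hd | rfl | hd
      exacts [le_rfl, (hu d hd).le, le_rfl, (hv d hd).le]
    simp only [List.replicate_succ, List.cons_append, rlMin, if_pos h, ih]
    omega

/-! ### Removing the smallest letter -/

theorem eqvGen_filter (x : A) {w₁ w₂ : List A} (h : Relation.EqvGen SylvesterAdj w₁ w₂) :
    Relation.EqvGen SylvesterAdj (w₁.filter (x < ·)) (w₂.filter (x < ·)) := by
  induction h with
  | rel _ _ h =>
    obtain ⟨u, v, w, a, b, c, hab, hbc, rfl, rfl⟩ := h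
    by_cases ha : x < a
    · have hb := ha.trans_le hab
      refine .rel _ _ ⟨u.filter (x < ·), v.filter (x < ·), w.filter (x < ·), a, b, c, hab, hbc,
        ?_, ?_⟩ <;> simp [ha, hb, hb.trans hbc]
    · have : (u ++ [a, c] ++ v ++ [b] ++ w).filter (x < ·)
          = (u ++ [c, a] ++ v ++ [b] ++ w).filter (x < ·) := by
        simp [List.filter_cons, ha]
      rw [this]
      exact .refl _
  | refl => exact .refl _
  | symm _ _ _ ih => exact ih.symm
  | trans _ _ _ _ _ ih₁ ih₂ => exact ih₁.trans _ _ _ ih₂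

/-- Splits a word along a decomposition `u ++ p :: q :: r` of its restriction to the letters
greater than `x`. -/
theorem filter_gt_eq_split {x p q : A} {W u r : List A}
    (h : W.filter (x < ·) = u ++ p :: q :: r) :
    ∃ U P Q, W = U ++ p :: (P ++ q :: Q) ∧ U.filter (x < ·) = u ∧ (∀ d ∈ P, d ≤ x) ∧
      Q.filter (x < ·) = r := by
  obtain ⟨U, V, rfl, hU, hV⟩ := List.filter_eq_append_iff.1 h
  obtain ⟨U', V', rfl, hU', -, hV'⟩ := List.filter_eq_cons_iff.1 hV
  obtain ⟨P, Q, rfl, hP, -, hQ⟩ := List.filter_eq_cons_iff.1 hV'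
  refine ⟨U ++ U', P, Q, by simp, ?_, by simpa using hP, hQ⟩
  rw [List.filter_append, hU, List.filter_eq_nil_iff.2 hU', List.append_nil]

/-- A Sylvester move on the letters greater than `x` lifts to the whole word: the letters at most
`x` that separate the two exchanged letters first slide out from between them, past the larger one. -/
theorem exists_eqvGen_filter_eq {x : A} {t t' : List A}
    (h : Relation.EqvGen SylvesterAdj t t') :
    (∀ W : List A, W.filter (x < ·) = t →
      ∃ W', Relation.EqvGen SylvesterAdj W W' ∧ W'.filter (x < ·) = t') ∧
    (∀ W : List A, W.filter (x < ·) = t' →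
      ∃ W', Relation.EqvGen SylvesterAdj W W' ∧ W'.filter (x < ·) = t) := by
  induction h with
  | rel _ _ h =>
    obtain ⟨u, v, w, a, b, c, hab, hbc, rfl, rfl⟩ := h
    have key : ∀ W : List A, (W.filter (x < ·)).Perm (u ++ a :: c :: (v ++ b :: w)) →
        x < a ∧ x < b ∧ x < c := by
      intro W hW
      have h : ∀ d ∈ u ++ a :: c :: (v ++ b :: w), x < d := fun d hd => by
        simpa using (List.mem_filter.1 (hW.mem_iff.2 hd)).2
      exact ⟨h a (by simp), h b (by simp), h c (by simp)⟩
    simp only [List.append_assoc, List.cons_append, List.nil_append]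
    have hmem : ∀ Q : List A, Q.filter (x < ·) = v ++ b :: w → b ∈ Q := fun Q hQ =>
      List.mem_of_mem_filter (hQ ▸ (by simp : b ∈ v ++ b :: w))
    constructor
    · intro W hW
      obtain ⟨hxa, hxb, hxc⟩ := key W (by rw [hW])
      obtain ⟨U, P, Q, rfl, rfl, hP, hQ⟩ := filter_gt_eq_split hW
      have hbQ := hmem Q hQ
      refine ⟨U ++ c :: a :: (P ++ Q), eqvGen_append_left _ ?_, ?_⟩
      · refine (eqvGen_cons a (eqvGen_block_swap hbQ hbc P
          fun d hd => (hP d hd).trans hxb.le)).trans _ _ _ ?_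
        exact eqvGen_swap (by simp [hbQ]) hab hbc
      · have : P.filter (x < ·) = [] := List.filter_eq_nil_iff.2 (by simpa using hP)
        simp [this, hQ, hxa, hxc]
    · intro W hW
      obtain ⟨hxa, hxb, hxc⟩ := key W (by
        rw [hW]; exact (List.Perm.swap _ _ _).append_left _)
      obtain ⟨U, P, Q, rfl, rfl, hP, hQ⟩ := filter_gt_eq_split hW
      have hbQ := hmem Q hQ
      have hP' : ∀ d ∈ P, d ≤ b := fun d hd => (hP d hd).trans hxb.le
      refine ⟨U ++ (P ++ a :: c :: Q), eqvGen_append_left _ ?_, ?_⟩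
      · have h₁ : Relation.EqvGen SylvesterAdj (P ++ c :: a :: Q) (c :: (P ++ a :: Q)) :=
          eqvGen_block_swap (by simp [hbQ]) hbc P hP'
        exact h₁.symm.trans _ _ _ (eqvGen_append_left P (eqvGen_swap hbQ hab hbc).symm)
      · have : P.filter (x < ·) = [] := List.filter_eq_nil_iff.2 (by simpa using hP)
        simp [this, hQ, hxa, hxc]
  | refl => exact ⟨fun W h => ⟨W, .refl _, h⟩, fun W h => ⟨W, .refl _, h⟩⟩
  | symm _ _ _ ih => exact ih.symm
  | trans _ _ _ _ _ ih₁ ih₂ =>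
    constructor
    · intro W hW
      obtain ⟨W₁, h₁, hW₁⟩ := ih₁.1 W hW
      obtain ⟨W₂, h₂, hW₂⟩ := ih₂.1 W₁ hW₁
      exact ⟨W₂, h₁.trans _ _ _ h₂, hW₂⟩
    · intro W hW
      obtain ⟨W₁, h₁, hW₁⟩ := ih₂.2 W hW
      obtain ⟨W₂, h₂, hW₂⟩ := ih₁.2 W₁ hW₁
      exact ⟨W₂, h₁.trans _ _ _ h₂, hW₂⟩

/-- Normal form for the smallest letter `x`: all of its occurrences but the last one move to the
front. -/
theorem exists_normalForm {x : A} (w : List A) (hw : ∀ c ∈ w, x ≤ c) {n : ℕ}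
    (hn : w.count x = n + 1) :
    ∃ u v, w.filter (x < ·) = u ++ v ∧
      Relation.EqvGen SylvesterAdj w (List.replicate n x ++ (u ++ x :: v)) := by
  induction w generalizing n with
  | nil => simp at hn
  | cons c w ih =>
    have hw' : ∀ d ∈ w, x ≤ d := fun d hd => hw d (by simp [hd])
    rcases (hw c (by simp)).eq_or_lt with rfl | hc
    · rw [List.count_cons_self, Nat.add_right_cancel_iff] at hn
      cases n with
      | zero =>
        have hx : x ∉ w := List.count_eq_zero.1 hn
        refine ⟨[], w, ?_, .refl _⟩
        have : w.filter (x < ·) = w := List.filter_eq_self.2 fun d hd => by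
          simpa using lt_of_le_of_ne (hw' d hd) fun h => hx (h ▸ hd)
        simp [this]
      | succ n =>
        obtain ⟨u, v, huv, h⟩ := ih hw' hn
        exact ⟨u, v, by simpa using huv, by
          simpa [List.replicate_succ] using eqvGen_cons x h⟩
    · rw [List.count_cons_of_ne hc.ne'] at hn
      obtain ⟨u, v, huv, h⟩ := ih hw' hn
      refine ⟨c :: u, v, by simp [hc, huv], (eqvGen_cons c h).trans _ _ _ ?_⟩
      have := eqvGen_block_swap (s := u ++ x :: v) (b := x) (by simp) hc (List.replicate n x)
        fun a ha => (List.eq_of_mem_replicate ha).le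
      simpa using this.symm

/-- The letter `x` slides over letters that contribute no right-to-left minimum. -/
theorem eqvGen_slide {x : A} (s v : List A) (hs : ∀ c ∈ s, x < c) (hv : ∀ c ∈ v, x < c)
    (h : rlMin (s ++ v) = rlMin v) :
    Relation.EqvGen SylvesterAdj (x :: (s ++ v)) (s ++ x :: v) := by
  induction s with
  | nil => exact .refl _
  | cons c s ih =>
    have hle := rlMin_le_append s v
    have hs' : ∀ d ∈ s, x < d := fun d hd => hs d (by simp [hd])
    simp only [List.cons_append, rlMin] at h
    have hc : ¬ ∀ d ∈ s ++ v, c ≤ d := fun h' => by rw [if_pos h'] at h; omega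
    rw [if_neg hc, zero_add] at h
    push Not at hc
    obtain ⟨d, hd, hdc⟩ := hc
    have hxd : x ≤ d := by
      rcases List.mem_append.1 hd with hd | hd
      exacts [(hs' d hd).le, (hv d hd).le]
    exact (eqvGen_swap hd hxd hdc).trans _ _ _ (eqvGen_cons c (ih hs' h))

/-- A word is determined up to Sylvester equivalence by its content, the class of its restriction
to the letters other than the smallest one, and its number of right-to-left minima. -/
theorem eqvGen_of_filter_eqvGen {x : A} {w w' : List A} (hw : ∀ c ∈ w, x ≤ c)
    (hx : x ∈ w) (hperm : w.Perm w')
    (hf : Relation.EqvGen SylvesterAdj (w.filter (x < ·)) (w'.filter (x < ·)))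
    (hr : rlMin w = rlMin w') : Relation.EqvGen SylvesterAdj w w' := by
  obtain ⟨w₁, h₁, hf₁⟩ := (exists_eqvGen_filter_eq hf).1 w rfl
  refine h₁.trans _ _ _ ?_
  have hp₁ := (eqvGen_perm h₁).symm
  obtain ⟨n, hn⟩ : ∃ n, w.count x = n + 1 :=
    Nat.exists_eq_add_one.2 (List.count_pos_iff.2 hx)
  obtain ⟨u, v, huv, he⟩ := exists_normalForm w₁ (fun c hc => hw c (hp₁.mem_iff.1 hc))
    ((hp₁.count_eq x).trans hn)
  obtain ⟨u', v', huv', he'⟩ := exists_normalForm w' (fun c hc => hw c (hperm.mem_iff.2 hc))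
    ((hperm.count_eq x).symm.trans hn)
  refine he.trans _ _ _ (Relation.EqvGen.trans _ _ _ ?_ he'.symm)
  have hgt : ∀ c ∈ u ++ v, x < c := fun c hc => by
    rw [← huv, List.mem_filter] at hc
    exact of_decide_eq_true hc.2
  have hgt' : ∀ c ∈ u' ++ v', x < c := fun c hc => by
    rw [← huv', List.mem_filter] at hc
    exact of_decide_eq_true hc.2
  simp only [List.mem_append, or_imp, forall_and] at hgt hgt'
  have hv : rlMin v = rlMin v' := by
    have e₁ := rlMin_eq_of_eqvGen he
    have e₂ := rlMin_eq_of_eqvGen he'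
    rw [rlMin_replicate_append x n hgt.1 hgt.2, ← rlMin_eq_of_eqvGen h₁] at e₁
    rw [rlMin_replicate_append x n hgt'.1 hgt'.2] at e₂
    omega
  refine eqvGen_append_left _ ?_
  have heq : u ++ v = u' ++ v' := by rw [← huv, ← huv', hf₁]
  rcases List.append_eq_append_iff.1 heq with ⟨s, rfl, rfl⟩ | ⟨s, rfl, rfl⟩
  · rw [List.append_assoc]
    exact eqvGen_append_left u
      (eqvGen_slide s v' (fun c hc => hgt.2 c (by simp [hc])) hgt'.2 hv)
  · rw [List.append_assoc]
    exact (eqvGen_append_left u'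
      (eqvGen_slide s v (fun c hc => hgt'.2 c (by simp [hc])) hgt.2 hv.symm)).symm

end Words

/-! ### Iterated summation and the Hessenberg determinant -/

open Finset in
/-- The operator `T_b` with `(T_b g)(t) = ∑_{j ≤ t} g (b + j)`. -/
def shiftSum (b : ℕ) (g : ℕ → ℤ) (t : ℕ) : ℤ :=
  ∑ j ∈ range (t + 1), g (b + j)

/-- The value at `0` of `T_{β 0} (T_{β 1} (⋯ (T_{β (i - 1)} g)))`. -/
def iterShiftSum (β : ℕ → ℕ) : ℕ → (ℕ → ℤ) → ℤ
  | 0, g => g 0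
  | i + 1, g => iterShiftSum β i (shiftSum (β i) g)

section Determinant

open Finset

theorem iterShiftSum_congr {β β' : ℕ → ℕ} {i : ℕ} (hβ : ∀ l < i, β l = β' l) (g : ℕ → ℤ) :
    iterShiftSum β i g = iterShiftSum β' i g := by
  induction i generalizing g with
  | zero => rfl
  | succ i ih =>
    simp only [iterShiftSum, hβ i (Nat.lt_succ_self i)]
    exact ih (fun l hl => hβ l (by omega)) _

/-- Only the values of `g` up to `β 0 + ⋯ + β (i - 1)` matter. -/
theorem iterShiftSum_congr_fun (β : ℕ → ℕ) (i : ℕ) {g g' : ℕ → ℤ}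
    (h : ∀ t ≤ ∑ l ∈ range i, β l, g t = g' t) : iterShiftSum β i g = iterShiftSum β i g' := by
  induction i generalizing g g' with
  | zero => exact h 0 (by simp)
  | succ i ih =>
    refine ih fun t ht => sum_congr rfl fun j hj => h _ ?_
    rw [sum_range_succ]
    have := mem_range.1 hj
    omega

theorem iterShiftSum_add (β : ℕ → ℕ) (i : ℕ) (g g' : ℕ → ℤ) :
    iterShiftSum β i (fun t => g t + g' t) = iterShiftSum β i g + iterShiftSum β i g' := by
  induction i generalizing g g' with
  | zero => rfl
  | succ i ih =>
    simp only [iterShiftSum, ← ih]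
    congr 1
    funext t
    exact sum_add_distrib

theorem iterShiftSum_mul (β : ℕ → ℕ) (i : ℕ) (c : ℤ) (g : ℕ → ℤ) :
    iterShiftSum β i (fun t => c * g t) = c * iterShiftSum β i g := by
  induction i generalizing g with
  | zero => rfl
  | succ i ih =>
    simp only [iterShiftSum, ← ih]
    congr 1
    funext t
    exact (mul_sum _ _ _).symm

/-- Iterated Pascal rule, summing down from `S + q` to `S - R + q`. -/
theorem choose_eq_add_sum (q r S R : ℕ) (h : R ≤ S) :
    (S + q + 1).choose (r + 1)
      = (S - R + q).choose (r + 1) + ∑ j ∈ range (R + 1), (S - j + q).choose r := by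
  induction R with
  | zero => simp [Nat.choose_succ_succ, add_comm]
  | succ R ih =>
    rw [ih (by omega), sum_range_succ _ (R + 1)]
    obtain ⟨T, hT⟩ : ∃ T, S - R = T + 1 := ⟨S - R - 1, by omega⟩
    have hT' : S - (R + 1) = T := by omega
    rw [hT, hT', show T + 1 + q = T + q + 1 by ring, Nat.choose_succ_succ]
    ring

/-- The linear relation between the numbers `iterShiftSum β (i + 1) 1` that expresses the
expansion of the leading principal minors of the Hessenberg matrix along their last columns.
The `i`-th summand splits by `choose_eq_add_sum` into two parts; the second one cancels
with the first part of the next summand. -/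
theorem sum_choose_mul_iterShiftSum (β : ℕ → ℕ) (q : ℕ) :
    ∑ i ∈ range (q + 2), (-1 : ℤ) ^ i *
      (((q + 1 + ∑ l ∈ range (i + 1), β l).choose (q + 1 - i) : ℤ)
        * iterShiftSum β (i + 1) fun _ => 1) = 0 := by
  set S : ℕ → ℕ := fun i => ∑ l ∈ range (i + 1), β l with hS
  set B : ℕ → ℤ := fun i => iterShiftSum β (i + 1) fun R =>
    ((S i - R + q).choose (q + 1 - i) : ℤ) with hB
  -- For `i = 0` only `R = S 0` occurs, so that the coefficient is `q.choose (q + 1) = 0`.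
  have hB0 : B 0 = 0 := by
    simp [hB, hS, iterShiftSum, shiftSum]
  have hlast : ((q + 1 + S (q + 1)).choose (q + 1 - (q + 1)) : ℤ)
      * iterShiftSum β (q + 1 + 1) (fun _ => 1) = B (q + 1) := by
    simp [hB]
  have hstep : ∀ i ∈ range (q + 1), ((q + 1 + S i).choose (q + 1 - i) : ℤ)
      * iterShiftSum β (i + 1) (fun _ => 1) = B i + B (i + 1) := by
    intro i hi
    have hi' := mem_range.1 hi
    obtain ⟨r, rfl⟩ : ∃ r, q = i + r := ⟨q - i, by omega⟩
    rw [← iterShiftSum_mul]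
    have h₁ : B (i + 1) = iterShiftSum β (i + 1) fun R =>
        ∑ j ∈ range (R + 1), ((S i - j + (i + r)).choose r : ℤ) := by
      simp only [hB]
      rw [iterShiftSum]
      congr 1
      funext R
      refine sum_congr rfl fun j _ => ?_
      have e₁ : S (i + 1) - (β (i + 1) + j) = S i - j := by
        simp only [hS, sum_range_succ _ (i + 1)]; omega
      have e₂ : i + r + 1 - (i + 1) = r := by omega
      simp only [e₁, e₂]
    rw [h₁, ← iterShiftSum_add]
    refine iterShiftSum_congr_fun β (i + 1) fun R hR => ?_
    have e : i + r + 1 - i = r + 1 := by omega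
    rw [e, mul_one, show i + r + 1 + S i = S i + (i + r) + 1 by ring,
      choose_eq_add_sum (i + r) r (S i) R hR]
    push_cast
    rfl
  rw [sum_range_succ, hlast]
  have htel : ∀ p, ∑ i ∈ range p, (-1 : ℤ) ^ i * (B i + B (i + 1)) = B 0 - (-1) ^ p * B p := by
    intro p
    induction p with
    | zero => simp
    | succ p ih => rw [sum_range_succ, ih, pow_succ]; ring
  rw [sum_congr rfl fun i hi => by rw [hstep i hi], htel, hB0]
  ring

/-- The determinant of a Hessenberg matrix with unit subdiagonal, from a sequence `D` of
candidates for the leading principal minors that satisfies the expansion along the last column. -/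
theorem det_hessenberg (a : ℕ → ℕ → ℤ) (D : ℕ → ℤ) (hD : D 0 = 1)
    (hsub : ∀ j, a (j + 1) j = 1) (hzero : ∀ i j, j + 1 < i → a i j = 0)
    (hrec : ∀ q, ∑ i ∈ range (q + 2), (-1 : ℤ) ^ i * (a i q * D i) = 0) (p : ℕ) :
    (Matrix.of fun i j : Fin p => a i j).det = D p := by
  cases p with
  | zero => simp [hD]
  | succ p =>
    set M : Matrix (Fin (p + 1)) (Fin (p + 1)) ℤ := Matrix.of fun i j => a i j with hM
    -- Replacing the first row by the combination of all rows with coefficients `(-1) ^ i * D i`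
    -- keeps the determinant, as `D 0 = 1`, and clears that row except for its last entry.
    have hrow : ∀ j : Fin (p + 1), (∑ i : Fin (p + 1), ((-1 : ℤ) ^ (i : ℕ) * D i) • M i) j
        = if (j : ℕ) = p then (-1) ^ p * D (p + 1) else 0 := by
      intro j
      have h₁ : (∑ i : Fin (p + 1), ((-1 : ℤ) ^ (i : ℕ) * D i) • M i) j
          = ∑ i ∈ range (p + 1), (-1 : ℤ) ^ i * (a i j * D i) := by
        rw [Finset.sum_apply, ← Fin.sum_univ_eq_sum_range
          (fun i => (-1 : ℤ) ^ i * (a i j * D i))]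
        refine sum_congr rfl fun i _ => ?_
        simp only [hM, Pi.smul_apply, smul_eq_mul, Matrix.of_apply]
        ring
      rw [h₁]
      split_ifs with hj
      · have := hrec p
        rw [sum_range_succ, hsub, one_mul, pow_succ] at this
        rw [hj]
        linarith
      · rw [← hrec j]
        refine (sum_subset (range_subset_range.2 (by omega)) fun i _ hi => ?_).symm
        rw [hzero i j (by rw [mem_range] at hi; omega), zero_mul, mul_zero]
    have hdet := Matrix.det_updateRow_sum M 0 fun i => (-1 : ℤ) ^ (i : ℕ) * D i
    rw [Fin.val_zero, pow_zero, hD, one_mul, one_smul] at hdet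
    rw [← hdet, Matrix.det_succ_row_zero, sum_eq_single (Fin.last p)]
    · rw [Matrix.updateRow_self, hrow, if_pos (Fin.val_last p), Fin.val_last]
      have hminor : ((M.updateRow 0
          (∑ i : Fin (p + 1), ((-1 : ℤ) ^ (i : ℕ) * D i) • M i)).submatrix
          Fin.succ (Fin.last p).succAbove).det = 1 := by
        rw [Matrix.det_of_isUpperTriangular]
        · refine prod_eq_one fun i _ => ?_
          simp [hM, Matrix.updateRow_ne, Fin.succ_ne_zero, hsub]
        · intro i j hij
          have hij' : (j : ℕ) < i := hij
          simp only [Matrix.submatrix_apply, Matrix.updateRow_ne (Fin.succ_ne_zero i), hM,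
            Matrix.of_apply, Fin.succAbove_last, Fin.val_succ, Fin.val_castSucc]
          exact hzero _ _ (by omega)
      rw [hminor, mul_one, ← mul_assoc, ← mul_pow]
      simp
    · intro j _ hj
      have : (j : ℕ) ≠ p := fun h => hj (Fin.ext h)
      rw [Matrix.updateRow_self, hrow, if_neg this, mul_zero, zero_mul]
    · simp

theorem det_sylvesterMatrix {n : ℕ} (α : Composition n) :
    (sylvesterMatrix α).det
      = iterShiftSum (fun l => α.blocks.reverse.getD l 0) α.length fun _ => 1 := by
  set β : ℕ → ℕ := fun l => α.blocks.reverse.getD l 0 with hβ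
  have hmat : sylvesterMatrix α = Matrix.of fun i j : Fin (α.length - 1) =>
      binom ((j : ℕ) + 1 + ∑ l ∈ range ((i : ℕ) + 1), β l)
        ((((j : ℕ) : ℤ) + 1) - (((i : ℕ) : ℤ) + 1) + 1) := by
    ext i j
    simp only [sylvesterMatrix, Matrix.of_apply]
    congr 2
    have hβ' : ∀ ℓ : Fin α.length, α.blocksFun ℓ.rev = β ℓ := by
      intro ℓ
      have h : (ℓ : ℕ) < α.blocks.reverse.length := by
        rw [List.length_reverse]; exact ℓ.2
      simp only [hβ, List.getD_eq_getElem _ _ h, Composition.blocksFun, List.getElem_reverse,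
        List.get_eq_getElem, Fin.val_rev]
      congr 1
      simp only [Composition.length]
      omega
    simp only [hβ']
    refine sum_nbij (fun ℓ => (ℓ : ℕ)) ?_ Fin.val_injective.injOn ?_ fun _ _ => rfl
    · intro ℓ hℓ
      simpa [Nat.lt_succ_iff] using hℓ
    · intro l hl
      have hl' : l < (i : ℕ) + 1 := by simpa using hl
      exact ⟨⟨l, by omega⟩, by simp; omega, rfl⟩
  rw [hmat, det_hessenberg
    (fun i j => binom (j + 1 + ∑ l ∈ range (i + 1), β l) (((j : ℤ) + 1) - ((i : ℤ) + 1) + 1))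
    (fun i => iterShiftSum β (i + 1) fun _ => 1)]
  · rcases Nat.eq_zero_or_pos α.length with h | h
    · rw [h]
      simp [iterShiftSum, shiftSum]
    · rw [Nat.sub_add_cancel h]
  · simp [iterShiftSum, shiftSum]
  · intro j
    simp [binom]
  · intro i j h
    exact if_neg (by omega)
  · intro q
    refine (sum_congr rfl fun i hi => ?_).trans (sum_choose_mul_iterShiftSum β q)
    have hi' := mem_range.1 hi
    have e : (q : ℤ) + 1 - ((i : ℤ) + 1) + 1 = ((q + 1 - i : ℕ) : ℤ) := by omega
    simp only [e, binom, Int.toNat_natCast, if_pos (Int.natCast_nonneg _)]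

end Determinant

/-! ### Counting the classes -/

section Counting

variable {A : Type*} [LinearOrder A]

theorem mk_eq_mk_iff_eqvGen {w w' : List A} :
    Quotient.mk (sylvesterSetoid A) w = Quotient.mk (sylvesterSetoid A) w' ↔
      Relation.EqvGen SylvesterAdj w w' :=
  Quotient.eq

/-- The number of right-to-left minima of the words of a Sylvester class. -/
def classRlMin : Quotient (sylvesterSetoid A) → ℕ :=
  Quotient.lift rlMin fun _ _ h => rlMin_eq_of_eqvGen h

/-- The class of the restrictions of the words of a Sylvester class to the letters greater than
`x`. -/
def classFilter (x : A) : Quotient (sylvesterSetoid A) → Quotient (sylvesterSetoid A) :=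
  Quotient.map (List.filter (x < ·)) fun _ _ h => eqvGen_filter x h

theorem finite_sylvesterClasses (m : Multiset A) : (sylvesterClasses m).Finite := by
  refine Set.Finite.image _ ((Multiset.lists m).finite_toSet.subset fun w hw => ?_)
  exact (Multiset.mem_lists_iff m w).2 (Eq.symm hw)

/-- Removing the smallest letter `x`, of multiplicity `n + 1`, is a bijection from the classes with
content `m` to the pairs of a class `C` with content `m.filter (x < ·)` and some
`j ≤ classRlMin C`, where `j + n + 1` is the number of right-to-left minima of the original
class. -/
theorem sum_sylvesterClasses_of_min {x : A} {m : Multiset A} (hx : ∀ c ∈ m, x ≤ c) {n : ℕ}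
    (hn : m.count x = n + 1) (g : ℕ → ℤ) :
    ∑ C ∈ (finite_sylvesterClasses m).toFinset, g (classRlMin C)
      = ∑ C ∈ (finite_sylvesterClasses (m.filter (x < ·))).toFinset,
          shiftSum (n + 1) g (classRlMin C) := by
  simp only [shiftSum]
  rw [Finset.sum_sigma']
  have key : ∀ w : List A, (w : Multiset A) = m → ∃ j ≤ rlMin (w.filter (x < ·)),
      rlMin w = n + 1 + j := by
    rintro w rfl
    obtain ⟨u, v, huv, h⟩ := exists_normalForm w hx (by simpa using hn)
    have hgt : ∀ c ∈ u ++ v, x < c := fun c hc => by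
      rw [← huv, List.mem_filter] at hc
      exact of_decide_eq_true hc.2
    simp only [List.mem_append, or_imp, forall_and] at hgt
    exact ⟨rlMin v, huv ▸ rlMin_le_append u v, (rlMin_eq_of_eqvGen h).trans
      (rlMin_replicate_append x n hgt.1 hgt.2)⟩
  refine Finset.sum_nbij
    (fun C => (⟨classFilter x C, classRlMin C - (n + 1)⟩ :
      (_ : Quotient (sylvesterSetoid A)) × ℕ)) ?_ ?_ ?_ ?_
  · intro C hC
    obtain ⟨w, hw, rfl⟩ := (Set.Finite.mem_toFinset _).1 hC
    obtain ⟨j, hj, hwj⟩ := key w hw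
    refine Finset.mem_sigma.2 ⟨(Set.Finite.mem_toFinset _).2
      ⟨w.filter (x < ·), ?_, rfl⟩, Finset.mem_range.2 ?_⟩
    · rw [Set.mem_ofPred_eq, ← Multiset.filter_coe, show (w : Multiset A) = m from hw]
    · change rlMin w - (n + 1) < rlMin (w.filter (x < ·)) + 1
      omega
  · intro C hC C' hC' h
    obtain ⟨w, hw, rfl⟩ := (Set.Finite.mem_toFinset _).1 hC
    obtain ⟨w', hw', rfl⟩ := (Set.Finite.mem_toFinset _).1 hC'
    obtain ⟨j, -, hwj⟩ := key w hw
    obtain ⟨j', -, hwj'⟩ := key w' hw'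
    simp only [Sigma.mk.injEq, heq_eq_eq] at h
    have h₂ : rlMin w - (n + 1) = rlMin w' - (n + 1) := h.2
    subst hw
    refine mk_eq_mk_iff_eqvGen.2 (eqvGen_of_filter_eqvGen hx ?_
      (Multiset.coe_eq_coe.1 (Eq.symm hw')) (mk_eq_mk_iff_eqvGen.1 h.1) (by omega))
    exact Multiset.mem_coe.1 (Multiset.count_pos.1 (hn ▸ n.succ_pos))
  · rintro ⟨D, j⟩ hD
    obtain ⟨hD, hj⟩ := Finset.mem_sigma.1 hD
    obtain ⟨t, ht, rfl⟩ := (Set.Finite.mem_toFinset _).1 hD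
    have hj' : j ≤ rlMin t := Nat.lt_succ_iff.1 (Finset.mem_range.1 hj)
    obtain ⟨u, v, rfl, rfl⟩ := exists_suffix_rlMin_eq t hj'
    have ht' : ((u ++ v : List A) : Multiset A) = m.filter (x < ·) := ht
    have hgt : ∀ c ∈ u ++ v, x < c := fun c hc => by
      rw [← Multiset.mem_coe, ht'] at hc
      exact (Multiset.mem_filter.1 hc).2
    have hfil : (List.replicate n x ++ (u ++ x :: v)).filter (x < ·) = u ++ v := by
      have h₁ := List.filter_eq_self.2 fun c hc => decide_eq_true (hgt c hc)
      simpa [List.filter_append] using h₁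
    have hgt' := hgt
    simp only [List.mem_append, or_imp, forall_and] at hgt'
    refine ⟨Quotient.mk _ (List.replicate n x ++ (u ++ x :: v)), ?_, ?_⟩
    · refine (Set.Finite.mem_toFinset _).2 ⟨_, ?_, rfl⟩
      rw [Set.mem_ofPred_eq]
      ext c
      rw [Multiset.coe_count]
      rcases eq_or_ne c x with rfl | hc
      · have hu : c ∉ u := fun h => lt_irrefl _ (hgt'.1 c h)
        have hv : c ∉ v := fun h => lt_irrefl _ (hgt'.2 c h)
        simp [List.count_eq_zero.2 hu, List.count_eq_zero.2 hv, hn]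
      · have h₁ : (u ++ v).count c = (m.filter (x < ·)).count c := by
          rw [← ht', Multiset.coe_count]
        have h₂ : (m.filter (x < ·)).count c = m.count c := by
          by_cases hcm : c ∈ m
          · exact Multiset.count_filter_of_pos (lt_of_le_of_ne (hx c hcm) hc.symm)
          · rw [Multiset.count_eq_zero_of_notMem hcm, Multiset.count_eq_zero]
            exact fun h => hcm (Multiset.mem_filter.1 h).1
        rw [← h₂, ← h₁]
        simp [List.count_replicate, hc.symm]
    · have h₁ : classFilter x (Quotient.mk _ (List.replicate n x ++ (u ++ x :: v)))
          = Quotient.mk _ (u ++ v) := congrArg (Quotient.mk _) hfil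
      have h₂ : classRlMin (Quotient.mk (sylvesterSetoid A) (List.replicate n x ++ (u ++ x :: v)))
          = n + 1 + rlMin v := rlMin_replicate_append x n hgt'.1 hgt'.2
      simp only [h₁, h₂, Nat.add_sub_cancel_left]
  · intro C hC
    obtain ⟨w, hw, rfl⟩ := (Set.Finite.mem_toFinset _).1 hC
    obtain ⟨j, -, hwj⟩ := key w hw
    change g (rlMin w) = g (n + 1 + (rlMin w - (n + 1)))
    congr 1
    omega

/-- The distribution of right-to-left minima over the classes of a given content, by induction
on the letters that occur, the smallest letter being removed first. -/
theorem sum_sylvesterClasses (l : List A) (hl : l.Pairwise (· < ·)) (m : Multiset A)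
    (hm : ∀ y, y ∈ m ↔ y ∈ l) (g : ℕ → ℤ) :
    ∑ C ∈ (finite_sylvesterClasses m).toFinset, g (classRlMin C)
      = iterShiftSum (fun i => (l.map fun y => m.count y).reverse.getD i 0) l.length g := by
  induction l generalizing m g with
  | nil =>
    obtain rfl : m = 0 := Multiset.eq_zero_of_forall_notMem fun y hy => by
      simpa using (hm y).1 hy
    have : (finite_sylvesterClasses (0 : Multiset A)).toFinset
        = {Quotient.mk (sylvesterSetoid A) []} := by
      ext C
      simp [sylvesterClasses]
    rw [this, Finset.sum_singleton]
    rfl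
  | cons x l ih =>
    rw [List.pairwise_cons] at hl
    have hx : ∀ c ∈ m, x ≤ c := fun c hc => by
      rcases List.mem_cons.1 ((hm c).1 hc) with rfl | h
      exacts [le_rfl, (hl.1 c h).le]
    obtain ⟨n, hn⟩ : ∃ n, m.count x = n + 1 :=
      Nat.exists_eq_add_one.2 (Multiset.count_pos.2 ((hm x).2 (by simp)))
    have hm' : ∀ y, y ∈ m.filter (x < ·) ↔ y ∈ l := by
      intro y
      rw [Multiset.mem_filter, hm, List.mem_cons]
      constructor
      · rintro ⟨rfl | h, hy⟩
        exacts [absurd hy (lt_irrefl _), h]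
      · exact fun h => ⟨Or.inr h, hl.1 y h⟩
    have hmap : (l.map fun y => (m.filter (x < ·)).count y) = l.map fun y => m.count y :=
      List.map_congr_left fun y hy => Multiset.count_filter_of_pos (hl.1 y hy)
    rw [sum_sylvesterClasses_of_min hx hn, ih hl.2 _ hm', hmap, List.length_cons, iterShiftSum]
    have hlast : (((x :: l).map fun y => m.count y).reverse.getD l.length 0) = n + 1 := by
      simp [hn]
    rw [hlast]
    refine iterShiftSum_congr (fun i hi => ?_) _
    rw [List.map_cons, List.reverse_cons, List.getD_append]
    simpa using hi

end Counting

theorem theorem4p2 {n : ℕ} (α : Composition n) {A : Type*} [LinearOrder A] (m : Multiset A)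
    (hm : packedContent m = α.blocks) :
    ((sylvesterClasses m).ncard : ℤ) = (sylvesterMatrix α).det := by
  have h := sum_sylvesterClasses (m.toFinset.sort (· ≤ ·)) (Finset.sortedLT_sort _).pairwise m
    (by simp) fun _ => 1
  rw [det_sylvesterMatrix, ← hm]
  have hlen : α.length = (m.toFinset.sort (· ≤ ·)).length := by
    rw [Composition.length, ← hm, packedContent, List.length_map]
  rw [hlen]
  refine Eq.trans ?_ h
  rw [Set.ncard_eq_toFinset_card _ (finite_sylvesterClasses m)]
  simp
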